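/- Let $G=(V,E)$ be a connected, locally finite graph which is regular of degree $\delta$, and let $\Gamma\le\operatorname{Aut}(G)$ be a subgroup acting transitively on $V$ that is unimodular, i.e. $\Gamma$ is a locally compact group in the topology of pointwise convergence and its left Haar measures are also right invariant. Let $\mu$ be a $\Gamma$-invariant probability measure on $\Omega=2^E$ (with the product $\sigma$-algebra), let $H(\omega)$ be the graph with vertex set $V$ whose edges are those in $\omega\in\Omega$, let $o\in V$, and let $\mathcal C_o=\mathcal C_o(\omega)$ be the vertex set of the connected component of $H(\omega)$ containing $o$. Assume that $|\mathcal C_o|<\infty$ $\mu$-almost surely and that, for some $\widehat N\in\mathbb N$, $\widehat N\ge 1$, and some constant $C$, $$\mu[\,|\mathcal C_o|=m\,]=C\,e^{-m/\widehat N}\qquad\text{for all } m\in\{1,2,3,\dots\}.$$ The regularised random walk on $H=H(\omega)$ has the transition matrix $A=\delta^{-1}(\mathcal A+\delta\,\mathbb I-D)$, where $\mathcal A$ is the adjacency matrix and $D$ the diagonal matrix of the vertex degrees of $H$; that is, it is the simple random walk on the graph obtained from $H$ by attaching $\delta-\deg_H(v)$ loops to each vertex $v$, a loop counting one for the degree.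 The continuous-time regularised random walk $\widehat X_t$ performs $n$ such independent steps in $[0,t]$ with probability $e^{-t}t^n/n!$, so that $\mathbb P^o[\widehat X_t=o]=\sum_{n\ge 0}e^{-t}\frac{t^n}{n!}(A^n)_{oo}$. Put $$\nu=\frac1{(\delta-1)\ln 16},\quad a=1+\frac{\sqrt{\pi\delta}}{2^{1-\nu}},\quad r=\frac{\nu}{1+\nu},\quad c=a\Bigl(1+e\bigl(1+(\widehat N+1)^{\frac1{1+2\nu}}\bigr)\Bigr),\quad \rho=4^{\frac{(1+\nu)^2}{2\nu}}.$$ Then, for every real $t\ge\frac{\delta}{4\widehat N}$, the random variables $\mathbb P^o[\widehat X_t=o]$ and $1/|\mathcal C_o|$ are $\mu$-integrable and $$\mathbb E_\mu\,\mathbb P^o[\widehat X_t=o]\;\le\;\mathbb E_\mu\Bigl[\frac1{|\mathcal C_o|}\Bigr]+c\,t^{-\frac16(1+r)}\exp\Bigl\{-\Bigl(\frac{4t}{\delta\widehat N^2}\Bigr)^{1/3}\Bigr\}+\sqrt{\rho}\;t^{1/4}e^{-\frac{4\sqrt t}{\delta\rho}}+e^{-\frac{t}{16\widehat N}} .$$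 -/

import Mathlib

open MeasureTheory

noncomputable section

namespace InvPerc

variable {V : Type*}

/-! ### Automorphism groups and unimodularity -/

/-- The topology of pointwise convergence on the automorphism group of a graph, the vertex set
being discrete: the stabilizers of finite sets of vertices are a basis at the identity. -/
instance autTopology (G : SimpleGraph V) : TopologicalSpace (G ≃g G) :=
  TopologicalSpace.induced (fun γ : G ≃g G => (γ : V → V))
    (@Pi.topologicalSpace V (fun _ => V) (fun _ => ⊥))

/-- The Borel sigma-algebra of the automorphism group. -/
instance autMeasurableSpace (G : SimpleGraph V) : MeasurableSpace (G ≃g G) := borel _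

instance autBorelSpace (G : SimpleGraph V) : BorelSpace (G ≃g G) := ⟨rfl⟩

/-- A group of automorphisms acts transitively on the vertices. -/
def IsVertexTransitive {G : SimpleGraph V} (Γ : Subgroup (G ≃g G)) : Prop :=
  ∀ v w : V, ∃ γ ∈ Γ, γ v = w

/-- A group of automorphisms is unimodular: it is a locally compact group (for the topology of
pointwise convergence) whose (left) Haar measures are also right invariant. -/
def IsUnimodular {G : SimpleGraph V} (Γ : Subgroup (G ≃g G)) : Prop :=
  LocallyCompactSpace Γ ∧ ∀ m : Measure Γ, m.IsHaarMeasure → m.IsMulRightInvariant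

/-! ### Percolation -/

/-- Edge configurations, the space `2^E` with its product sigma-algebra; `ω e = true` means that
the edge `e` is kept. -/
abbrev Config (G : SimpleGraph V) : Type _ := G.edgeSet → Bool

/-- The random partial graph: all vertices, and the edges kept by `ω`. -/
def openGraph (G : SimpleGraph V) (ω : Config G) : SimpleGraph V where
  Adj v w := ∃ h : G.Adj v w, ω ⟨s(v, w), G.mem_edgeSet.mpr h⟩ = true
  symm := ⟨by
    rintro v w ⟨h, hω⟩
    refine ⟨h.symm, ?_⟩
    have hs : (⟨s(w, v), G.mem_edgeSet.mpr h.symm⟩ : G.edgeSet)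
        = ⟨s(v, w), G.mem_edgeSet.mpr h⟩ := Subtype.ext Sym2.eq_swap
    rw [hs]; exact hω⟩
  loopless := ⟨fun v ⟨h, _⟩ => G.loopless.irrefl v h⟩

/-- The cluster of `o`: the vertex set of the connected component containing `o`. -/
def cluster (G : SimpleGraph V) (ω : Config G) (o : V) : Set V :=
  {v | (openGraph G ω).Reachable o v}

/-- The law `μ` of the configuration is invariant under the group `Γ` of automorphisms. -/
def IsInvariant {G : SimpleGraph V} (Γ : Subgroup (G ≃g G)) (μ : Measure (Config G)) : Prop :=
  ∀ γ ∈ Γ, μ.map (fun (ω : Config G) (e : G.edgeSet) => ω (γ.mapEdgeSet e)) = μ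

/-! ### The regularised random walk

Throughout, `H` is a graph all of whose degrees are finite and at most `δ`. -/

open Classical in
/-- Adjacency matrix of the regularisation of `H`: at every vertex `v`, `δ - deg v` loops are
attached, each of which counts one. -/
def regAdj (H : SimpleGraph V) (δ : ℕ) (v w : V) : ℝ :=
  (if H.Adj v w then 1 else 0) + (if v = w then (δ : ℝ) - ((H.neighborSet v).ncard : ℝ) else 0)

/-- Transition matrix of the regularised random walk: the simple random walk on the
regularisation, which is regular of degree `δ`. -/
def rrwKernel (H : SimpleGraph V) (δ : ℕ) (v w : V) : ℝ := regAdj H δ v w / (δ : ℝ)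

open Classical in
/-- The `n`-step transition probabilities, that is, the entries of the `n`-th power of the
transition matrix (each row of which has finitely many nonzero entries). -/
def rrwStep (H : SimpleGraph V) (δ : ℕ) : ℕ → V → V → ℝ
  | 0, v, w => if v = w then 1 else 0
  | n + 1, v, w => ∑' u, rrwKernel H δ v u * rrwStep H δ n u w

/-- The transition probability from `v` to `w` in time `t` of the continuous-time regularised
random walk, which performs `n` independent steps in `[0, t]` with probability
`exp (-t) * t ^ n / n!`. -/
def rrwHeat (H : SimpleGraph V) (δ : ℕ) (t : ℝ) (v w : V) : ℝ :=
  ∑' n : ℕ, Real.exp (-t) * t ^ n / (n.factorial : ℝ) * rrwStep H δ n v w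

/-! ### Constants -/

/-- The constant `ν`. -/
def nuC (δ : ℕ) : ℝ := 1 / (((δ : ℝ) - 1) * Real.log 16)

/-- The constant `a`. -/
def aC (δ : ℕ) : ℝ := 1 + Real.sqrt (Real.pi * δ) / (2 : ℝ) ^ (1 - nuC δ)

/-- The constant `r`. -/
def rC (δ : ℕ) : ℝ := nuC δ / (1 + nuC δ)

/-- The constant `c`, depending on the degree and on the parameter `N` of the cluster law. -/
def cC (δ N : ℕ) : ℝ :=
  aC δ * (1 + Real.exp 1 * (1 + ((N : ℝ) + 1) ^ (1 / (1 + 2 * nuC δ))))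

/-- The constant `ρ`. -/
def rhoC (δ : ℕ) : ℝ := (4 : ℝ) ^ ((1 + nuC δ) ^ 2 / (2 * nuC δ))

end InvPerc

end

/-! The walk never leaves the cluster of `o`, which is almost surely finite, and there it is a
symmetric Markov chain. Cauchy–Schwarz along a path joining a maximum to a minimum of a function,
together with Popoviciu's inequality, gives a spectral gap of at least 4/(δm²) on a cluster of size
m (`SimpleGraph.Connected.poincare`). The spectral expansion turns this into a return probability of
at most 1/m + exp(-4t/(δm²)) (`InvPerc.hasSum_rrwHeat_of_finite`).

It remains to average the exponential against C exp(-m/N). Half of m/N is set aside to form a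
geometric series, whose normalised sum is bounded uniformly in N. With y = (4t/(δN²))^(1/3), the
other half plus 4t/(δm²) is at least 1.185 y for every m. As 1.185 > 1, the surplus exp(-0.185 y)
pays for the power of t, and the constant c pays for the factors in δ and N
(`InvPerc.exp_le_cC_mul`). The first error term therefore suffices; of the other two only
nonnegativity is used. -/

/-! ### Poincaré inequality on a finite connected graph -/

/-- Cauchy–Schwarz for the telescoping sum of increments along the path. The factor 2 is gained
because the double sum counts each edge in both directions. -/
theorem SimpleGraph.Walk.IsPath.sq_sub_le_length_mul_energy {W : Type*} [DecidableEq W]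
    {H : SimpleGraph W} {g : W → W → ℝ} {f : W → ℝ} {κ : ℝ} (hsymm : ∀ u v, g u v = g v u)
    (hnn : ∀ u v, 0 ≤ g u v) (hadj : ∀ u v, H.Adj u v → κ * (f u - f v) ^ 2 ≤ g u v)
    (hκ : 0 ≤ κ) {p q : W} (P : H.Walk p q) (hP : P.IsPath) :
    2 * κ * (f p - f q) ^ 2
      ≤ P.length * ∑ u ∈ P.support.toFinset, ∑ v ∈ P.support.toFinset, g u v := by
  induction P with
  | nil => simp
  | @cons p p' q h P ih =>
    rw [SimpleGraph.Walk.cons_isPath_iff] at hP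
    have ih := ih hP.1
    have hp : p ∉ P.support.toFinset := by simpa using hP.2
    have hp' : p' ∈ P.support.toFinset := by simp
    rw [SimpleGraph.Walk.support_cons, List.toFinset_cons, Finset.sum_insert hp,
      Finset.sum_insert hp]
    simp only [Finset.sum_insert hp, Finset.sum_add_distrib, SimpleGraph.Walk.length_cons]
    set S := P.support.toFinset
    have e1 : ∑ v ∈ S, g p v = ∑ u ∈ S, g u p := Finset.sum_congr rfl fun v _ => hsymm p v
    have e2 : g p p' ≤ ∑ v ∈ S, g p v := Finset.single_le_sum (fun v _ => hnn p v) hp'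
    have e3 := hadj p p' h
    have e4 := hnn p p
    set E := ∑ u ∈ S, ∑ v ∈ S, g u v
    set T := ∑ v ∈ S, g p v
    rw [← e1]
    push_cast
    set a := f p - f p'
    set b := f p' - f q
    have hab : f p - f q = a + b := by simp [a, b]
    rw [hab]
    have hE : 0 ≤ E := Finset.sum_nonneg fun u _ => Finset.sum_nonneg fun v _ => hnn u v
    have hT : κ * a ^ 2 ≤ T := e3.trans e2
    -- The induction rests on (a+b)² ≤ (ℓ+1)a² + (1+1/ℓ)b² with ℓ the length of the tail, so ℓ = 0
    -- is treated apart.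
    rcases Nat.eq_zero_or_pos P.length with hl | hl
    · have hb : 2 * κ * b ^ 2 ≤ 0 := by simpa [hl] using ih
      have hb' : κ * b ^ 2 = 0 := le_antisymm (by linarith) (by positivity)
      have hκab : κ * (a + b) ^ 2 = κ * a ^ 2 := by
        rcases mul_eq_zero.1 hb' with h0 | h0
        · simp [h0]
        · simp [pow_eq_zero_iff] at h0; simp [h0]
      rw [hl]; push_cast; nlinarith
    · have hl' : (0 : ℝ) < P.length := by exact_mod_cast hl
      have hcs : 2 * κ * (a + b) ^ 2
          ≤ (P.length + 1) * (2 * κ * a ^ 2) + (1 + 1 / P.length) * (2 * κ * b ^ 2) := by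
        have : 0 ≤ 2 * κ * ((P.length * a - b) ^ 2 / P.length) := by positivity
        have e : 2 * κ * ((P.length * a - b) ^ 2 / P.length)
            = (P.length + 1) * (2 * κ * a ^ 2) + (1 + 1 / P.length) * (2 * κ * b ^ 2)
              - 2 * κ * (a + b) ^ 2 := by field_simp; ring
        linarith
      have hb : (1 + 1 / (P.length : ℝ)) * (2 * κ * b ^ 2) ≤ (P.length + 1) * E := by
        calc _ ≤ (1 + 1 / (P.length : ℝ)) * (P.length * E) := by gcongr
          _ = _ := by field_simp
      nlinarith

open Finset in
/-- Popoviciu's inequality, in the centred case. -/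
theorem sum_sq_le_of_sum_eq_zero {W : Type*} [Fintype W] {f : W → ℝ} {x y : ℝ}
    (hf : ∑ v, f v = 0) (hx : ∀ v, x ≤ f v) (hy : ∀ v, f v ≤ y) :
    ∑ v, f v ^ 2 ≤ Fintype.card W * ((y - x) ^ 2 / 4) := by
  have h : ∑ v, f v ^ 2 ≤ ∑ v, ((x + y) * f v - x * y) :=
    sum_le_sum fun v _ => by nlinarith [hx v, hy v, mul_nonneg (sub_nonneg.2 (hx v)) (sub_nonneg.2 (hy v))]
  rw [sum_sub_distrib, ← mul_sum, hf] at h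
  simp only [sum_const, card_univ, nsmul_eq_mul] at h
  have : (0 : ℝ) ≤ Fintype.card W * (x + y) ^ 2 := by positivity
  nlinarith

/-- Popoviciu bounds the sum of squares by the squared oscillation, which the path estimate between
the extremal points bounds by the energy. One factor |W| comes from each. -/
theorem SimpleGraph.Connected.poincare {W : Type*} [Fintype W] {H : SimpleGraph W}
    (hH : H.Connected) {g : W → W → ℝ} {f : W → ℝ} {κ : ℝ} (hsymm : ∀ u v, g u v = g v u)
    (hnn : ∀ u v, 0 ≤ g u v) (hadj : ∀ u v, H.Adj u v → κ * (f u - f v) ^ 2 ≤ g u v)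
    (hκ : 0 ≤ κ) (hf : ∑ v, f v = 0) :
    8 * κ * ∑ v, f v ^ 2 ≤ (Fintype.card W : ℝ) ^ 2 * ∑ u, ∑ v, g u v := by
  classical
  have := hH.nonempty
  obtain ⟨p, hp⟩ := Finite.exists_max f
  obtain ⟨q, hq⟩ := Finite.exists_min f
  obtain ⟨P, hP⟩ := (hH.preconnected p q).exists_isPath
  have h1 := hP.sq_sub_le_length_mul_energy hsymm hnn hadj hκ P
  have h2 : ∑ u ∈ P.support.toFinset, ∑ v ∈ P.support.toFinset, g u v ≤ ∑ u, ∑ v, g u v :=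
    (Finset.sum_le_sum fun u _ => Finset.sum_le_sum_of_subset_of_nonneg (Finset.subset_univ _)
      fun v _ _ => hnn u v).trans (Finset.sum_le_sum_of_subset_of_nonneg (Finset.subset_univ _)
      fun u _ _ => Finset.sum_nonneg fun v _ => hnn u v)
  have h3 : (P.length : ℝ) ≤ Fintype.card W := by exact_mod_cast hP.length_lt.le
  have h4 := sum_sq_le_of_sum_eq_zero hf hq hp
  have hE : 0 ≤ ∑ u, ∑ v, g u v := Finset.sum_nonneg fun u _ => Finset.sum_nonneg fun v _ => hnn u v
  calc 8 * κ * ∑ v, f v ^ 2 ≤ 8 * κ * (Fintype.card W * ((f p - f q) ^ 2 / 4)) := by gcongr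
    _ = Fintype.card W * (2 * κ * (f p - f q) ^ 2) := by ring
    _ ≤ Fintype.card W * (Fintype.card W * ∑ u, ∑ v, g u v) := by
        refine mul_le_mul_of_nonneg_left (h1.trans (mul_le_mul h3 h2 (Finset.sum_nonneg fun u _ =>
          Finset.sum_nonneg fun v _ => hnn u v) (by positivity))) (by positivity)
    _ = _ := by ring

/-! ### Spectral decomposition of the return probability -/

open Matrix in
theorem Matrix.sum_mul_sq_sub_of_mulVec_eq_smul {W : Type*} [Fintype W] {M : Matrix W W ℝ}
    (hM : M.IsSymm) (hrow : ∀ v, ∑ w, M v w = 1) {f : W → ℝ} {μ : ℝ} (hf : M *ᵥ f = μ • f) :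
    ∑ u, ∑ v, M u v * (f u - f v) ^ 2 = 2 * (1 - μ) * ∑ v, f v ^ 2 := by
  have hf' : ∀ u, ∑ v, M u v * f v = μ * f u := fun u => congrFun hf u
  have e1 : ∑ u, ∑ v, M u v * f u ^ 2 = ∑ u, f u ^ 2 := by
    simp [← Finset.sum_mul, hrow]
  have e2 : ∑ u, ∑ v, M u v * f v ^ 2 = ∑ u, f u ^ 2 := by
    rw [Finset.sum_comm, ← e1]
    exact Finset.sum_congr rfl fun u _ => Finset.sum_congr rfl fun v _ => by rw [hM.apply]
  have e3 : ∑ u, ∑ v, M u v * (f u * f v) = μ * ∑ u, f u ^ 2 := by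
    rw [Finset.mul_sum]
    refine Finset.sum_congr rfl fun u _ => ?_
    rw [← mul_one (f u ^ 2), sq, mul_one, ← mul_assoc, ← hf' u, Finset.sum_mul]
    exact Finset.sum_congr rfl fun v _ => by ring
  have e : ∀ u v, M u v * (f u - f v) ^ 2
      = M u v * f u ^ 2 + M u v * f v ^ 2 - 2 * (M u v * (f u * f v)) := fun u v => by ring
  simp only [e, Finset.sum_sub_distrib, Finset.sum_add_distrib, e1, e2, ← Finset.mul_sum, e3]
  ring

open Matrix in
/-- Continuous-time return probabilities of a symmetric random walk on a finite connected graph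
approach the uniform distribution at the rate given by the Poincaré inequality. -/
theorem Matrix.exists_hasSum_poisson_pow_le {W : Type*} [Fintype W] [DecidableEq W]
    {H : SimpleGraph W} (hH : H.Connected) {M : Matrix W W ℝ} {κ : ℝ} (hκ : 0 < κ)
    (hM : M.IsSymm) (hrow : ∀ v, ∑ w, M v w = 1) (hnn : ∀ u v, u ≠ v → 0 ≤ M u v)
    (hadj : ∀ u v, H.Adj u v → κ ≤ M u v) {t : ℝ} (ht : 0 ≤ t) (o : W) :
    ∃ s : ℝ, HasSum (fun n : ℕ => Real.exp (-t) * t ^ n / (n.factorial : ℝ) * (M ^ n) o o) s ∧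
      0 ≤ s ∧ s ≤ 1 / Fintype.card W + Real.exp (-(4 * κ * t / (Fintype.card W : ℝ) ^ 2)) := by
  have hne := hH.nonempty
  have hcard : (0 : ℝ) < Fintype.card W := by exact_mod_cast Fintype.card_pos
  have hA : M.IsHermitian := by
    rw [Matrix.IsHermitian, Matrix.conjTranspose_eq_transpose_of_trivial]; exact hM
  set ψ := hA.eigenvectorBasis
  set ev := hA.eigenvalues
  have heig : ∀ j, M *ᵥ (ψ j : W → ℝ) = ev j • (ψ j : W → ℝ) := fun j =>
    hA.mulVec_eigenvectorBasis j
  have hpow : ∀ n j, (M ^ n) *ᵥ (ψ j : W → ℝ) = ev j ^ n • (ψ j : W → ℝ) := by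
    intro n j
    induction n with
    | zero => simp
    | succ n ih => rw [pow_succ, ← Matrix.mulVec_mulVec, heig, Matrix.mulVec_smul, ih, smul_smul,
        pow_succ']
  have hexp : ∀ f : W → ℝ, f = ∑ j, (∑ v, f v * ψ j v) • (ψ j : W → ℝ) := by
    intro f
    have h := ψ.sum_repr' (WithLp.toLp 2 f)
    have h2 := congrArg WithLp.ofLp h
    simp only [WithLp.ofLp_sum, WithLp.ofLp_smul] at h2
    refine h2.symm.trans (Finset.sum_congr rfl fun j _ => ?_)
    congr 1
  have hpars : ∀ f : W → ℝ, ∑ j, (∑ v, f v * ψ j v) ^ 2 = ∑ v, f v ^ 2 := by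
    intro f
    conv_rhs => enter [2, v]; rw [sq]; enter [2]; rw [hexp f]
    simp only [Finset.sum_apply, Pi.smul_apply, smul_eq_mul, Finset.mul_sum]
    rw [Finset.sum_comm]
    refine Finset.sum_congr rfl fun j _ => ?_
    rw [sq, Finset.mul_sum]
    exact Finset.sum_congr rfl fun v _ => by ring
  have hnorm : ∀ j, ∑ v, ψ j v ^ 2 = 1 := by
    intro j
    have := ψ.norm_eq_one j
    rw [EuclideanSpace.norm_eq, Real.sqrt_eq_one] at this
    simpa using this
  have hentry : ∀ n, (M ^ n) o o = ∑ j, ψ j o ^ 2 * ev j ^ n := by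
    intro n
    have h1 : (M ^ n) o o = ((M ^ n) *ᵥ Pi.single o 1) o := by simp
    rw [h1, hexp (Pi.single o 1), Matrix.mulVec_sum, Finset.sum_apply]
    refine Finset.sum_congr rfl fun j _ => ?_
    rw [Matrix.mulVec_smul, hpow]
    simp [Pi.single_apply]
    ring
  have hsum : HasSum (fun n : ℕ => Real.exp (-t) * t ^ n / (n.factorial : ℝ) * (M ^ n) o o)
      (∑ j, ψ j o ^ 2 * Real.exp (-(t * (1 - ev j)))) := by
    have : ∀ n : ℕ, Real.exp (-t) * t ^ n / (n.factorial : ℝ) * (M ^ n) o o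
        = ∑ j, ψ j o ^ 2 * (Real.exp (-t) * ((t * ev j) ^ n / (n.factorial : ℝ))) := by
      intro n
      rw [hentry, Finset.mul_sum]
      exact Finset.sum_congr rfl fun j _ => by rw [mul_pow]; ring
    simp only [this]
    refine hasSum_sum fun j _ => HasSum.mul_left _ ?_
    have h := (NormedSpace.expSeries_div_hasSum_exp (t * ev j)).mul_left (Real.exp (-t))
    rw [← Real.exp_eq_exp_ℝ, ← Real.exp_add] at h
    convert h using 2
    ring
  refine ⟨_, hsum, Finset.sum_nonneg fun j _ => by positivity, ?_⟩
  set G := Real.exp (-(4 * κ * t / (Fintype.card W : ℝ) ^ 2))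
  -- Diagonal entries meet a zero increment, so their sign is irrelevant.
  have hg0 : ∀ f : W → ℝ, ∀ u v, 0 ≤ M u v * (f u - f v) ^ 2 := by
    intro f u v
    rcases eq_or_ne u v with rfl | h
    · simp
    · exact mul_nonneg (hnn u v h) (sq_nonneg _)
  have hgs : ∀ f : W → ℝ, ∀ u v, M u v * (f u - f v) ^ 2 = M v u * (f v - f u) ^ 2 := by
    intro f u v
    rw [hM.apply]; ring
  have hga : ∀ f : W → ℝ, ∀ u v, H.Adj u v → κ * (f u - f v) ^ 2 ≤ M u v * (f u - f v) ^ 2 :=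
    fun f u v h => mul_le_mul_of_nonneg_right (hadj u v h) (sq_nonneg _)
  -- One bound for both kinds of eigenvector: for eigenvalue 1 the vector is constant and the first
  -- summand is exact; otherwise the vector has mean zero and the gap gives the second. Parseval for
  -- the constant function 1 then sums the first summands to 1/|W|.
  have key : ∀ j, ψ j o ^ 2 * Real.exp (-(t * (1 - ev j)))
      ≤ 1 / (Fintype.card W : ℝ) ^ 2 * (∑ v, 1 * ψ j v) ^ 2 + ψ j o ^ 2 * G := by
    intro j
    have hen := Matrix.sum_mul_sq_sub_of_mulVec_eq_smul hM hrow (heig j)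
    rw [hnorm] at hen
    by_cases h1 : ev j = 1
    · have hconst : ∀ v, ψ j v = ψ j o := by
        intro v
        obtain ⟨P, hP⟩ := (hH.preconnected v o).exists_isPath
        have h2 := hP.sq_sub_le_length_mul_energy (hgs (ψ j)) (hg0 (ψ j)) (hga (ψ j)) hκ.le P
        have h3 : ∀ u w, M u w * (ψ j u - ψ j w) ^ 2 = 0 := by
          rw [h1] at hen
          norm_num at hen
          intro u w
          rw [Finset.sum_eq_zero_iff_of_nonneg fun u _ =>
            Finset.sum_nonneg fun w _ => hg0 (ψ j) u w] at hen
          have := hen u (Finset.mem_univ _)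
          rw [Finset.sum_eq_zero_iff_of_nonneg fun w _ => hg0 (ψ j) u w] at this
          exact this w (Finset.mem_univ _)
        simp only [h3, Finset.sum_const_zero, mul_zero] at h2
        have h4 : (ψ j v - ψ j o) ^ 2 ≤ 0 := by
          by_contra h
          push Not at h
          have : 0 < 2 * κ * (ψ j v - ψ j o) ^ 2 := by positivity
          linarith
        have := pow_eq_zero_iff (two_ne_zero) |>.1 (le_antisymm h4 (sq_nonneg _))
        linarith
      have hG0 : 0 ≤ ψ j o ^ 2 * G := by positivity
      have : ∑ v, 1 * ψ j v = Fintype.card W * ψ j o := by simp [hconst]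
      rw [this, h1]
      have e : 1 / (Fintype.card W : ℝ) ^ 2 * (Fintype.card W * ψ j o) ^ 2 = ψ j o ^ 2 := by
        field_simp
      rw [e]
      simpa using hG0
    · have hmean : ∑ v, ψ j v = 0 := by
        have h2 : ∑ u, ∑ v, M u v * ψ j v = ∑ v, ψ j v := by
          rw [Finset.sum_comm]
          refine Finset.sum_congr rfl fun v _ => ?_
          rw [← Finset.sum_mul]
          have : ∑ u, M u v = 1 := by rw [← hrow v]; exact Finset.sum_congr rfl fun u _ => hM.apply _ _
          rw [this, one_mul]
        have h3 : ∑ u, ∑ v, M u v * ψ j v = ev j * ∑ v, ψ j v := by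
          rw [Finset.mul_sum]
          exact Finset.sum_congr rfl fun u _ => congrFun (heig j) u
        have h4 : (1 - ev j) * ∑ v, ψ j v = 0 := by rw [sub_mul, ← h3, h2]; ring
        exact (mul_eq_zero.1 h4).resolve_left (sub_ne_zero.2 (Ne.symm h1))
      have hp := hH.poincare (hgs (ψ j)) (hg0 (ψ j)) (hga (ψ j)) hκ.le hmean
      rw [hnorm, hen] at hp
      have hgap : 4 * κ / (Fintype.card W : ℝ) ^ 2 ≤ 1 - ev j := by
        rw [div_le_iff₀ (by positivity)]; linarith
      have : Real.exp (-(t * (1 - ev j))) ≤ G := by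
        apply Real.exp_le_exp.2
        have := mul_le_mul_of_nonneg_left hgap ht
        have e : 4 * κ * t / (Fintype.card W : ℝ) ^ 2 = t * (4 * κ / (Fintype.card W : ℝ) ^ 2) := by
          ring
        rw [e]; linarith
      have h5 := mul_le_mul_of_nonneg_left this (sq_nonneg (ψ j o))
      have h6 : 0 ≤ 1 / (Fintype.card W : ℝ) ^ 2 * (∑ v, 1 * ψ j v) ^ 2 := by positivity
      linarith
  refine (Finset.sum_le_sum fun j _ => key j).trans ?_
  rw [Finset.sum_add_distrib, ← Finset.mul_sum, ← Finset.sum_mul, hpars]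
  have h7 : ∑ j, ψ j o ^ 2 = 1 := by
    have := hentry 0
    simpa using this.symm
  rw [h7]
  simp only [one_pow, Finset.sum_const, Finset.card_univ, nsmul_eq_mul, mul_one, one_mul]
  apply le_of_eq
  congr 1
  field_simp

/-! ### Numerical estimates for the constants and the exponent -/

theorem InvPerc.nuC_nonneg {δ : ℕ} (hδ : 1 ≤ δ) : 0 ≤ InvPerc.nuC δ := by
  have h : (1 : ℝ) ≤ δ := by exact_mod_cast hδ
  exact div_nonneg zero_le_one (mul_nonneg (by linarith) (Real.log_nonneg (by norm_num)))

theorem InvPerc.nuC_le_half {δ : ℕ} (hδ : 1 ≤ δ) : InvPerc.nuC δ ≤ 1 / 2 := by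
  rcases hδ.eq_or_lt with rfl | h
  -- For δ = 1 the denominator vanishes, and division by zero gives ν = 0.
  · norm_num [InvPerc.nuC]
  · have h2 : (2 : ℝ) ≤ δ := by exact_mod_cast h
    have hl : (2 : ℝ) ≤ Real.log 16 := by
      rw [show (16 : ℝ) = 2 ^ 4 by norm_num, Real.log_pow]
      have := Real.log_two_gt_d9
      push_cast; linarith
    rw [InvPerc.nuC]
    exact one_div_le_one_div_of_le two_pos (by nlinarith)

/-- With w = δ^(1/4), this is the AM–GM bound 1 + 0.886 w² ≥ 1.88 w, where 0.886 is just below √π/2.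
-/
theorem InvPerc.le_aC {δ : ℕ} (hδ : 1 ≤ δ) : 1.88 * (δ : ℝ) ^ (1 / 4 : ℝ) ≤ InvPerc.aC δ := by
  have hν := InvPerc.nuC_nonneg hδ
  have h2 : (2 : ℝ) ^ (1 - InvPerc.nuC δ) ≤ 2 := by
    calc _ ≤ (2 : ℝ) ^ (1 : ℝ) := Real.rpow_le_rpow_of_exponent_le (by norm_num) (by linarith)
      _ = 2 := Real.rpow_one 2
  set w := (δ : ℝ) ^ (1 / 4 : ℝ) with hw
  have hw0 : 0 ≤ w := by positivity
  have hw4 : w ^ 4 = δ := by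
    rw [hw, ← Real.rpow_natCast, ← Real.rpow_mul (by positivity)]; norm_num
  have hs : 1.772 * w ^ 2 ≤ Real.sqrt (Real.pi * δ) := by
    apply Real.le_sqrt_of_sq_le
    rw [← hw4]
    have := Real.pi_gt_d6
    nlinarith [pow_nonneg hw0 4]
  have : Real.sqrt (Real.pi * δ) / 2 ≤ Real.sqrt (Real.pi * δ) / 2 ^ (1 - InvPerc.nuC δ) := by
    gcongr
  rw [InvPerc.aC]
  nlinarith [sq_nonneg (w - 1.06)]

/-- The constant comes from 0.63³ > 1/4. -/
theorem Real.rpow_le_one_add_of_le_third {s y : ℝ} (hs : 0 ≤ s) (hs' : s ≤ 1 / 3) (hy : 0 ≤ y) :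
    (y ^ 3 / 4) ^ s ≤ 1 + 0.63 * y := by
  rcases le_total (y ^ 3 / 4) 1 with h | h
  · have := Real.rpow_le_one (by positivity) h hs
    nlinarith
  · calc (y ^ 3 / 4) ^ s ≤ (y ^ 3 / 4) ^ (1 / 3 : ℝ) := Real.rpow_le_rpow_of_exponent_le h hs'
      _ ≤ ((0.63 * y) ^ 3) ^ (1 / 3 : ℝ) := by
          refine Real.rpow_le_rpow (by positivity) ?_ (by norm_num)
          nlinarith [pow_nonneg hy 3]
      _ = 0.63 * y := by
          rw [← Real.rpow_natCast, ← Real.rpow_mul (by positivity)]; norm_num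
      _ ≤ _ := by linarith

/-- With s = (1+r)/6, the power t^s splits into powers of δ, N² and y³/4. These are absorbed by a,
by the power of N+1 in c, and by exp(0.185 y) respectively. -/
theorem InvPerc.exp_le_cC_mul {δ N : ℕ} (hδ : 1 ≤ δ) (hN : 1 ≤ N) {t y : ℝ} (ht : 0 < t)
    (hy : 0 ≤ y) (hty : t = δ * ((N : ℝ) ^ 2 * (y ^ 3 / 4))) :
    2.65 * Real.exp (-(1.185 * y))
      ≤ InvPerc.cC δ N * t ^ (-(1 / 6 : ℝ) * (1 + InvPerc.rC δ)) * Real.exp (-y) := by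
  have hν := InvPerc.nuC_nonneg hδ
  have hν' := InvPerc.nuC_le_half hδ
  have ha := InvPerc.le_aC hδ
  have hδ' : (1 : ℝ) ≤ δ := by exact_mod_cast hδ
  have hN' : (1 : ℝ) ≤ N := by exact_mod_cast hN
  set ν := InvPerc.nuC δ with hνdef
  set s := (1 / 6 : ℝ) * (1 + InvPerc.rC δ) with hs
  have hsν : s = (1 + 2 * ν) / (6 * (1 + ν)) := by
    rw [hs, InvPerc.rC, ← hνdef]; field_simp; ring
  have hs0 : 0 ≤ s := by rw [hsν]; positivity
  have hs4 : s ≤ 1 / 4 := by rw [hsν, div_le_div_iff₀ (by positivity) (by norm_num)]; linarith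
  have hsp : s * 2 ≤ 1 / (1 + 2 * ν) := by
    rw [hsν, div_mul_eq_mul_div, div_le_div_iff₀ (by positivity) (by positivity)]; nlinarith
  set P := ((N : ℝ) + 1) ^ (1 / (1 + 2 * ν)) with hP
  have hP0 : 0 < P := by positivity
  set w := (δ : ℝ) ^ (1 / 4 : ℝ) with hw
  have hw0 : 0 < w := by positivity
  have h1 : t ^ s ≤ w * (P * (1 + 0.63 * y)) := by
    rw [hty, Real.mul_rpow (by positivity) (by positivity),
      Real.mul_rpow (by positivity) (by positivity)]
    have e1 : (δ : ℝ) ^ s ≤ w := Real.rpow_le_rpow_of_exponent_le hδ' hs4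
    have e2 : ((N : ℝ) ^ 2) ^ s ≤ P := by
      calc ((N : ℝ) ^ 2) ^ s = (N : ℝ) ^ (s * 2) := by
            rw [← Real.rpow_natCast, ← Real.rpow_mul (by positivity), mul_comm]; norm_num
        _ ≤ (N : ℝ) ^ (1 / (1 + 2 * ν)) := Real.rpow_le_rpow_of_exponent_le hN' hsp
        _ ≤ P := Real.rpow_le_rpow (by positivity) (by linarith) (by positivity)
    have e3 := Real.rpow_le_one_add_of_le_third hs0 (by linarith) hy
    gcongr
  have h2 : 1 + 0.63 * y ≤ 1.8 * Real.exp (0.185 * y) := by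
    have := Real.quadratic_le_exp_of_nonneg (x := 0.185 * y) (by positivity)
    nlinarith [sq_nonneg (y - 4.8)]
  -- Only the summand a·e·P of c is kept: 1.88 · 2.718 > 5.1, which exceeds the required 2.65 · 1.8
  -- = 4.77.
  have h3 : 5.1 * (w * P) ≤ InvPerc.cC δ N := by
    have he : (2.718 : ℝ) ≤ Real.exp 1 := by have := Real.exp_one_gt_d9; linarith
    have ha0 : 0 ≤ InvPerc.aC δ := le_trans (by positivity) ha
    calc 5.1 * (w * P) ≤ (1.88 * w) * (2.718 * P) := by nlinarith [mul_pos hw0 hP0]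
      _ ≤ InvPerc.aC δ * (Real.exp 1 * P) := by gcongr
      _ ≤ InvPerc.cC δ N := by
          rw [InvPerc.cC]
          apply mul_le_mul_of_nonneg_left _ ha0
          have := Real.exp_pos 1
          linarith
  have h4 : 2.65 * t ^ s ≤ InvPerc.cC δ N * Real.exp (0.185 * y) := by
    calc 2.65 * t ^ s ≤ 2.65 * (w * (P * (1.8 * Real.exp (0.185 * y)))) := by
          have := h1.trans (show _ ≤ w * (P * (1.8 * Real.exp (0.185 * y))) by gcongr)
          linarith
      _ = 4.77 * (w * P) * Real.exp (0.185 * y) := by ring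
      _ ≤ InvPerc.cC δ N * Real.exp (0.185 * y) := by
          refine mul_le_mul_of_nonneg_right (le_trans ?_ h3) (Real.exp_pos _).le
          nlinarith [mul_pos hw0 hP0]
  have e : -(1 / 6 : ℝ) * (1 + InvPerc.rC δ) = -s := by rw [hs]; ring
  have hts : 0 < t ^ s := by positivity
  rw [e, Real.rpow_neg ht.le, show -y = 0.185 * y + -(1.185 * y) by ring, Real.exp_add,
    ← mul_assoc]
  refine mul_le_mul_of_nonneg_right ?_ (Real.exp_pos _).le
  rw [mul_right_comm, ← div_eq_mul_inv, le_div_iff₀ hts]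
  exact h4

/-- Minimising z/2 + y³/z² gives z = 4^(1/3) y with value about 1.19 y. Rounding 4^(1/3) to 1.58
gives a product without a zy² term, whose y³ coefficient is below 1. -/
theorem Real.mul_sq_le_cube_add_cube {y z : ℝ} (hy : 0 ≤ y) (hz : 0 ≤ z) :
    1.185 * y * z ^ 2 ≤ z ^ 3 / 2 + y ^ 3 := by
  have h : 0 ≤ (z - 1.58 * y) ^ 2 * (z / 2 + 0.395 * y) := by positivity
  nlinarith [pow_nonneg hy 3]

/-- The exponent `m / N + 4 t / (δ m²)` after half of `m / N` has been set aside. -/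
theorem Real.exp_neg_div_mul_exp_neg_le {m N δ t y : ℝ} (hm : 0 < m) (hN : 0 < N) (hδ : 0 < δ)
    (hy : 0 ≤ y) (hty : t = δ * (N ^ 2 * (y ^ 3 / 4))) :
    Real.exp (-m / N) * Real.exp (-(4 * (1 / δ) * t / m ^ 2))
      ≤ Real.exp (-(1 / (2 * N)) * m) * Real.exp (-(1.185 * y)) := by
  rw [← Real.exp_add, ← Real.exp_add, Real.exp_le_exp, hty]
  have h := Real.mul_sq_le_cube_add_cube hy (div_pos hm hN).le
  have h2 : 1.185 * y ≤ m / N / 2 + y ^ 3 / (m / N) ^ 2 := by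
    have hz : 0 < (m / N) ^ 2 := by positivity
    rw [← mul_le_mul_iff_left₀ hz]
    refine h.trans (le_of_eq ?_)
    field_simp
  have e : -m / N + -(4 * (1 / δ) * (δ * (N ^ 2 * (y ^ 3 / 4))) / m ^ 2)
      = -(1 / (2 * N)) * m - (m / N / 2 + y ^ 3 / (m / N) ^ 2) := by
    field_simp; ring
  rw [e]; linarith

/-! ### The regularised walk on a finite cluster -/

namespace InvPerc

variable {V : Type*}

theorem regAdj_comm (H : SimpleGraph V) (δ : ℕ) (v w : V) : regAdj H δ v w = regAdj H δ w v := by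
  unfold regAdj
  rcases eq_or_ne v w with rfl | h
  · rfl
  · simp only [h, h.symm, if_false, add_zero]
    congr 1
    exact propext (H.adj_comm v w)

theorem rrwKernel_of_adj {H : SimpleGraph V} {v w : V} (h : H.Adj v w) (δ : ℕ) :
    rrwKernel H δ v w = 1 / δ := by
  simp [rrwKernel, regAdj, h, h.ne]

theorem rrwKernel_eq_zero {H : SimpleGraph V} {v w : V} (h : ¬ H.Adj v w) (hne : v ≠ w) (δ : ℕ) :
    rrwKernel H δ v w = 0 := by
  simp [rrwKernel, regAdj, h, hne]

theorem sum_rrwKernel_supp {H : SimpleGraph V} (c : H.ConnectedComponent) [Fintype c] {δ : ℕ}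
    (hδ : 1 ≤ δ) (v : c) : ∑ w : c, rrwKernel H δ v w = 1 := by
  classical
  have h1 : ∑ w : c, (if H.Adj v w then (1 : ℝ) else 0) = ((H.neighborSet v).ncard : ℝ) := by
    have : H.neighborSet v = (Subtype.val '' {w : c | H.Adj v w}) := by
      ext w
      simp only [SimpleGraph.mem_neighborSet, Set.mem_image, Set.mem_ofPred_eq, Subtype.exists,
        exists_and_left, exists_prop, exists_eq_right_right]
      exact ⟨fun h => ⟨h, c.mem_supp_of_adj_mem_supp v.2 h⟩, fun h => h.1⟩
    rw [this, Set.ncard_image_of_injective _ Subtype.val_injective, Finset.sum_boole,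
      Set.ncard_eq_toFinset_card', Set.toFinset_ofPred]
  have h2 : ∑ w : c, regAdj H δ v w = δ := by
    simp only [regAdj, Finset.sum_add_distrib]
    have h3 : ∑ w : c, (if (v : V) = w then (δ : ℝ) - ((H.neighborSet v).ncard : ℝ) else 0)
        = δ - ((H.neighborSet v).ncard : ℝ) := by
      simp only [← Subtype.ext_iff, Finset.sum_ite_eq, Finset.mem_univ, if_true]
    rw [h3]
    convert add_sub_cancel ((H.neighborSet v).ncard : ℝ) (δ : ℝ) using 2
  simp only [rrwKernel, ← Finset.sum_div, h2]
  exact div_self (by positivity)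

-- No step leaves a component, so the sum over all vertices collapses to a finite matrix product.
open Classical in
theorem rrwStep_eq_pow {H : SimpleGraph V} (c : H.ConnectedComponent) [Fintype c] (δ n : ℕ)
    (v w : c) :
    rrwStep H δ n v w = ((Matrix.of fun x y : c => rrwKernel H δ x y) ^ n) v w := by
  induction n generalizing v with
  | zero => simp only [rrwStep, pow_zero, Matrix.one_apply, Subtype.ext_iff]
  | succ n ih =>
    rw [rrwStep, pow_succ', Matrix.mul_apply]
    rw [← tsum_subtype_eq_of_support_subset (s := c.supp), tsum_fintype]
    · exact Finset.sum_congr rfl fun u _ => by rw [Matrix.of_apply, ih]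
    · intro u hu
      by_contra hc
      refine hu ?_
      have hne : (v : V) ≠ u := fun h => hc (h ▸ v.2)
      have hadj : ¬ H.Adj v u := fun h => hc (c.mem_supp_of_adj_mem_supp v.2 h)
      simp only [rrwKernel_eq_zero hadj hne, zero_mul]

/-- On a finite cluster of size `m`, the heat kernel exceeds `1 / m` by at most
`exp (-4 t / (δ m²))`. -/
theorem hasSum_rrwHeat_of_finite {G : SimpleGraph V} {ω : Config G} {o : V}
    (hfin : (cluster G ω o).Finite) {δ : ℕ} (hδ : 1 ≤ δ) {t : ℝ} (ht : 0 ≤ t) :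
    1 ≤ (cluster G ω o).ncard ∧
    HasSum (fun n : ℕ => Real.exp (-t) * t ^ n / (n.factorial : ℝ)
      * rrwStep (openGraph G ω) δ n o o) (rrwHeat (openGraph G ω) δ t o o) ∧
    0 ≤ rrwHeat (openGraph G ω) δ t o o ∧
    rrwHeat (openGraph G ω) δ t o o ≤ 1 / ((cluster G ω o).ncard : ℝ)
      + Real.exp (-(4 * (1 / (δ : ℝ)) * t / ((cluster G ω o).ncard : ℝ) ^ 2)) := by
  classical
  set H := openGraph G ω
  set c := H.connectedComponentMk o
  have hc : cluster G ω o = c.supp := by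
    ext v
    simp only [cluster, Set.mem_ofPred_eq, SimpleGraph.ConnectedComponent.mem_supp_iff]
    rw [SimpleGraph.ConnectedComponent.eq]
    exact SimpleGraph.reachable_comm
  rw [hc] at hfin ⊢
  let _ : Fintype c := hfin.fintype
  have hcard : c.supp.ncard = Fintype.card c := by
    rw [← Nat.card_coe_set_eq, Nat.card_eq_fintype_card]; rfl
  let o' : c := ⟨o, rfl⟩
  have hδ' : (0 : ℝ) < δ := by exact_mod_cast hδ
  obtain ⟨s, hs, hs0, hs1⟩ := Matrix.exists_hasSum_poisson_pow_le c.connected_toSimpleGraph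
    (M := Matrix.of fun x y : c => rrwKernel H δ x y) (κ := 1 / δ) (by positivity)
    (by
      ext x y
      simp only [Matrix.transpose_apply, Matrix.of_apply, rrwKernel, regAdj_comm H δ y x])
    (fun v => sum_rrwKernel_supp c hδ v)
    (fun u v huv => by
      rw [Matrix.of_apply]
      by_cases h : H.Adj u v
      · rw [rrwKernel_of_adj h]; positivity
      · rw [rrwKernel_eq_zero h (fun e => huv (Subtype.ext e))])
    (fun u v huv => by
      rw [Matrix.of_apply, rrwKernel_of_adj (show H.Adj (u : V) v from huv)]) ht o'
  have hs' : HasSum (fun n : ℕ => Real.exp (-t) * t ^ n / (n.factorial : ℝ)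
      * rrwStep H δ n o o) s := by
    convert hs using 3 with n
    exact rrwStep_eq_pow c δ n o' o'
  have e : rrwHeat H δ t o o = s := hs'.tsum_eq
  rw [e, hcard]
  exact ⟨Fintype.card_pos_iff.2 ⟨o'⟩, hs', hs0, hs1⟩

/-! ### Measurability -/

theorem countable_of_connected {G : SimpleGraph V} [G.LocallyFinite] (hconn : G.Connected) :
    Countable V := by
  obtain ⟨o⟩ := hconn.nonempty
  have h : ∀ n : ℕ, {v | ∃ p : G.Walk v o, p.length = n}.Countable := by
    intro n
    induction n with
    | zero =>
      refine (Set.countable_singleton o).mono ?_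
      rintro v ⟨p, hp⟩
      exact SimpleGraph.Walk.eq_of_length_eq_zero hp
    | succ n ih =>
      refine (ih.biUnion fun u _ => (Set.toFinite (G.neighborSet u)).countable).mono ?_
      rintro v ⟨p, hp⟩
      cases p with
      | nil => simp at hp
      | cons h q => exact Set.mem_biUnion ⟨q, by simpa using hp⟩ h.symm
  refine Set.countable_univ_iff.1 ((Set.countable_iUnion h).mono fun v _ => ?_)
  obtain ⟨p⟩ := hconn.preconnected v o
  exact Set.mem_iUnion.2 ⟨p.length, p, rfl⟩

theorem measurableSet_openGraph_adj (G : SimpleGraph V) (v w : V) :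
    MeasurableSet {ω : Config G | (openGraph G ω).Adj v w} := by
  by_cases h : G.Adj v w
  · have : {ω : Config G | (openGraph G ω).Adj v w}
        = (fun ω : Config G => ω ⟨s(v, w), G.mem_edgeSet.mpr h⟩) ⁻¹' {true} := by
      ext ω
      exact ⟨fun ⟨_, h⟩ => h, fun h' => ⟨h, h'⟩⟩
    rw [this]
    exact measurable_pi_apply _ (measurableSet_singleton _)
  · convert MeasurableSet.empty
    ext ω
    exact iff_of_false (fun ⟨h', _⟩ => h h') id

theorem measurableSet_mem_cluster [Countable V] (G : SimpleGraph V) (o v : V) :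
    MeasurableSet {ω : Config G | v ∈ cluster G ω o} := by
  have h : ∀ (n : ℕ) (u : V),
      MeasurableSet {ω : Config G | ∃ p : (openGraph G ω).Walk u v, p.length = n} := by
    intro n
    induction n with
    | zero =>
      intro u
      have : {ω : Config G | ∃ p : (openGraph G ω).Walk u v, p.length = 0}
          = {_ω : Config G | u = v} := by
        ext ω
        exact ⟨fun ⟨p, hp⟩ => SimpleGraph.Walk.eq_of_length_eq_zero hp,
          fun h => ⟨SimpleGraph.Walk.nil.copy rfl h, by simp⟩⟩
      rw [this]
      exact MeasurableSet.const _
    | succ n ih =>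
      intro u
      have : {ω : Config G | ∃ p : (openGraph G ω).Walk u v, p.length = n + 1}
          = ⋃ x : V, {ω : Config G | (openGraph G ω).Adj u x} ∩
            {ω : Config G | ∃ p : (openGraph G ω).Walk x v, p.length = n} := by
        ext ω
        simp only [Set.mem_iUnion, Set.mem_inter_iff, Set.mem_ofPred_eq]
        constructor
        · rintro ⟨p, hp⟩
          cases p with
          | nil => simp at hp
          | cons h q => exact ⟨_, h, q, by simpa using hp⟩
        · rintro ⟨x, h, q, hq⟩
          exact ⟨SimpleGraph.Walk.cons h q, by simp [hq]⟩
      rw [this]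
      exact MeasurableSet.iUnion fun x => (measurableSet_openGraph_adj G u x).inter (ih x)
  have : {ω : Config G | v ∈ cluster G ω o}
      = ⋃ n : ℕ, {ω : Config G | ∃ p : (openGraph G ω).Walk o v, p.length = n} := by
    ext ω
    simp only [Set.mem_iUnion, Set.mem_ofPred_eq, cluster]
    exact ⟨fun ⟨p⟩ => ⟨p.length, p, rfl⟩, fun ⟨_, p, _⟩ => ⟨p⟩⟩
  rw [this]
  exact MeasurableSet.iUnion fun n => h n o

theorem measurable_ncard_cluster [Countable V] (G : SimpleGraph V) (o : V) :
    Measurable fun ω : Config G => (cluster G ω o).ncard := by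
  classical
  have h1 : Measurable fun ω : Config G =>
      ∑' v : V, (if v ∈ cluster G ω o then (1 : ENNReal) else 0) :=
    Measurable.tsum fun v =>
      Measurable.ite (measurableSet_mem_cluster G o v) measurable_const measurable_const
  -- On an infinite cluster both sides take the default value 0.
  have h2 : ∀ ω : Config G, (∑' v : V, (if v ∈ cluster G ω o then (1 : ENNReal) else 0)).toReal
      = (cluster G ω o).ncard := by
    intro ω
    have e : ∑' v : V, (if v ∈ cluster G ω o then (1 : ENNReal) else 0)
        = (cluster G ω o).encard := by
      rw [← ENNReal.tsum_set_one, tsum_subtype (cluster G ω o) fun _ => (1 : ENNReal)]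
      rfl
    rw [e, Set.ncard_def]
    rcases eq_or_ne (cluster G ω o).encard ⊤ with h | h
    · simp [h]
    · lift (cluster G ω o).encard to ℕ using h with k
      simp
  refine measurable_to_countable' fun m => ?_
  convert (h1.ennreal_toReal) (measurableSet_singleton (m : ℝ)) using 1
  ext ω
  simp [h2]

theorem measurable_rrwKernel (G : SimpleGraph V) [G.LocallyFinite] (δ : ℕ) (v w : V) :
    Measurable fun ω : Config G => rrwKernel (openGraph G ω) δ v w := by
  classical
  have h : ∀ ω : Config G, (((openGraph G ω).neighborSet v).ncard : ℝ)
      = ∑ u ∈ G.neighborFinset v, if (openGraph G ω).Adj v u then (1 : ℝ) else 0 := by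
    intro ω
    rw [Finset.sum_boole, ← Set.ncard_coe_finset]
    congr 2
    ext u
    simp only [SimpleGraph.mem_neighborSet, Finset.coe_filter, SimpleGraph.mem_neighborFinset,
      Set.mem_ofPred_eq]
    exact ⟨fun h => ⟨h.1, h⟩, fun h => h.2⟩
  unfold rrwKernel regAdj
  simp only [h]
  have hm : ∀ u, Measurable fun ω : Config G =>
      if (openGraph G ω).Adj v u then (1 : ℝ) else 0 := fun u =>
    Measurable.ite (measurableSet_openGraph_adj G v u) measurable_const measurable_const
  refine Measurable.div_const (Measurable.add ?_ ?_) _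
  · convert hm w
  · by_cases hvw : v = w
    · simp only [hvw, if_true] at hm ⊢
      exact measurable_const.sub (Finset.measurable_sum _ fun u _ => hm u)
    · simp only [hvw, if_false]
      exact measurable_const

theorem measurable_rrwStep (G : SimpleGraph V) [G.LocallyFinite] (δ n : ℕ) (v w : V) :
    Measurable fun ω : Config G => rrwStep (openGraph G ω) δ n v w := by
  classical
  induction n generalizing v with
  | zero => exact measurable_const
  | succ n ih =>
    have h : ∀ ω : Config G, rrwStep (openGraph G ω) δ (n + 1) v w
        = ∑ u ∈ insert v (G.neighborFinset v),
          rrwKernel (openGraph G ω) δ v u * rrwStep (openGraph G ω) δ n u w := by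
      intro ω
      refine tsum_eq_sum fun u hu => ?_
      rw [Finset.mem_insert, not_or, SimpleGraph.mem_neighborFinset] at hu
      have hadj : ¬ (openGraph G ω).Adj v u := fun ⟨h, _⟩ => hu.2 h
      rw [rrwKernel_eq_zero hadj (Ne.symm hu.1), zero_mul]
    simp only [h]
    exact Finset.measurable_sum _ fun u _ => (measurable_rrwKernel G δ v u).mul (ih u)

/-- The Poisson series is the limit of measurable partial sums wherever the cluster is finite, which
is almost everywhere. -/
theorem aemeasurable_rrwHeat {G : SimpleGraph V} [G.LocallyFinite] {μ : Measure (Config G)} {o : V}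
    (hfin : ∀ᵐ ω ∂μ, (cluster G ω o).Finite) {δ : ℕ} (hδ : 1 ≤ δ) {t : ℝ} (ht : 0 ≤ t) :
    AEMeasurable (fun ω => rrwHeat (openGraph G ω) δ t o o) μ := by
  refine aemeasurable_of_tendsto_metrizable_ae Filter.atTop (f := fun (k : ℕ) ω =>
    ∑ n ∈ Finset.range k, Real.exp (-t) * t ^ n / (n.factorial : ℝ)
      * rrwStep (openGraph G ω) δ n o o) (fun k => ?_) ?_
  · exact (Finset.measurable_sum _ fun n _ =>
      (measurable_rrwStep G δ n o o).const_mul _).aemeasurable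
  · filter_upwards [hfin] with ω hω
    exact (hasSum_rrwHeat_of_finite hω hδ ht).2.1.tendsto_sum_nat

end InvPerc

/-! ### Averaging over a geometric law -/

theorem MeasureTheory.lintegral_comp_nat {Ω : Type*} [MeasurableSpace Ω] (μ : Measure Ω)
    {X : Ω → ℕ} (hX : Measurable X) (F : ℕ → ENNReal) :
    ∫⁻ ω, F (X ω) ∂μ = ∑' m, F m * μ (X ⁻¹' {m}) := by
  rw [← lintegral_map (Measurable.of_discrete) hX, lintegral_countable']
  exact tsum_congr fun m => by rw [Measure.map_apply hX (measurableSet_singleton m)]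

/-- A geometric law on the positive integers is normalised by its ratio. -/
theorem InvPerc.const_eq_of_geometric {Ω : Type*} [MeasurableSpace Ω] {μ : Measure Ω}
    [IsProbabilityMeasure μ] {X : Ω → ℕ} (hX : Measurable X) (hX0 : μ (X ⁻¹' {0}) = 0)
    {C q : ℝ} (hq0 : 0 < q) (hq1 : q < 1)
    (hlaw : ∀ m : ℕ, 1 ≤ m → μ.real (X ⁻¹' {m}) = C * q ^ m) : C = (1 - q) / q := by
  have hC : 0 ≤ C := by
    have h := hlaw 1 le_rfl
    have : 0 ≤ C * q ^ 1 := h ▸ measureReal_nonneg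
    exact nonneg_of_mul_nonneg_left this (by positivity)
  have h1 := lintegral_comp_nat μ hX fun _ => 1
  rw [lintegral_const, measure_univ, one_mul, tsum_eq_zero_add' ENNReal.summable, hX0] at h1
  have h2 : ∀ m : ℕ, 1 * μ (X ⁻¹' {m + 1}) = ENNReal.ofReal (C * q * q ^ m) := by
    intro m
    rw [one_mul, ← ofReal_measureReal, hlaw (m + 1) (by omega)]
    congr 1; ring
  simp only [h2] at h1
  have hs := (hasSum_geometric_of_lt_one hq0.le hq1).mul_left (C * q)
  rw [← ENNReal.ofReal_tsum_of_nonneg (fun m => by positivity) hs.summable, hs.tsum_eq, mul_zero,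
    zero_add] at h1
  have h3 := congrArg ENNReal.toReal h1
  rw [ENNReal.toReal_one, ENNReal.toReal_ofReal
    (mul_nonneg (by positivity) (inv_nonneg.2 (by linarith)))] at h3
  have : 1 - q ≠ 0 := by linarith
  field_simp at h3 ⊢
  linarith

theorem InvPerc.integral_le_of_geometric_bound {Ω : Type*} [MeasurableSpace Ω] {μ : Measure Ω}
    [IsProbabilityMeasure μ] {X : Ω → ℕ} (hX : Measurable X) (hX0 : μ (X ⁻¹' {0}) = 0)
    {F : ℕ → ℝ} (hF : ∀ m, 0 ≤ F m) {K p : ℝ} (hK : 0 ≤ K) (hp0 : 0 < p) (hp1 : p < 1)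
    (hb : ∀ m : ℕ, 1 ≤ m → F m * μ.real (X ⁻¹' {m}) ≤ K * p ^ m) :
    ∫ ω, F (X ω) ∂μ ≤ K * (p / (1 - p)) := by
  have hm : Measurable fun ω => F (X ω) := Measurable.of_discrete.comp hX
  rw [integral_eq_lintegral_of_nonneg_ae (Filter.Eventually.of_forall fun ω => hF _)
    hm.aestronglyMeasurable]
  have hnn : 0 ≤ K * (p / (1 - p)) :=
    mul_nonneg hK (div_nonneg hp0.le (by linarith))
  refine ENNReal.toReal_le_of_le_ofReal hnn ?_
  rw [lintegral_comp_nat μ hX fun m => ENNReal.ofReal (F m), tsum_eq_zero_add' ENNReal.summable,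
    hX0, mul_zero, zero_add]
  have hs := (hasSum_geometric_of_lt_one hp0.le hp1).mul_left (K * p)
  rw [show K * (p / (1 - p)) = K * p * (1 - p)⁻¹ by rw [div_eq_mul_inv, mul_assoc], ← hs.tsum_eq,
    ENNReal.ofReal_tsum_of_nonneg (fun m => by positivity) hs.summable]
  refine ENNReal.tsum_le_tsum fun m => ?_
  rw [← ofReal_measureReal, ← ENNReal.ofReal_mul (hF _)]
  refine ENNReal.ofReal_le_ofReal ((hb (m + 1) (by omega)).trans (le_of_eq ?_))
  ring

/-! ### The annealed bound -/

theorem theorem2p2 {V : Type*} (G : SimpleGraph V) [G.LocallyFinite] (hconn : G.Connected)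
    (δ : ℕ) (hδ : G.IsRegularOfDegree δ)
    (Γ : Subgroup (G ≃g G)) (htrans : InvPerc.IsVertexTransitive Γ)
    (huni : InvPerc.IsUnimodular Γ)
    (μ : MeasureTheory.Measure (InvPerc.Config G)) [MeasureTheory.IsProbabilityMeasure μ]
    (hinv : InvPerc.IsInvariant Γ μ) (o : V) (N : ℕ) (hN : 1 ≤ N)
    (hfin : ∀ᵐ ω ∂μ, (InvPerc.cluster G ω o).Finite)
    (C : ℝ)
    (hlaw : ∀ m : ℕ, 1 ≤ m →
      μ.real {ω | (InvPerc.cluster G ω o).ncard = m} = C * Real.exp (-(m : ℝ) / (N : ℝ)))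
    (t : ℝ) (ht : (δ : ℝ) / (4 * (N : ℝ)) ≤ t) :
    MeasureTheory.Integrable
        (fun ω => InvPerc.rrwHeat (InvPerc.openGraph G ω) δ t o o) μ ∧
      MeasureTheory.Integrable (fun ω => 1 / ((InvPerc.cluster G ω o).ncard : ℝ)) μ ∧
      ∫ ω, InvPerc.rrwHeat (InvPerc.openGraph G ω) δ t o o ∂μ ≤
        (∫ ω, 1 / ((InvPerc.cluster G ω o).ncard : ℝ) ∂μ)
          + InvPerc.cC δ N * t ^ (-(1 / 6 : ℝ) * (1 + InvPerc.rC δ))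
              * Real.exp (-((4 * t / ((δ : ℝ) * (N : ℝ) ^ 2)) ^ (1 / 3 : ℝ)))
          + Real.sqrt (InvPerc.rhoC δ) * t ^ (1 / 4 : ℝ)
              * Real.exp (-(4 * Real.sqrt t / ((δ : ℝ) * InvPerc.rhoC δ)))
          + Real.exp (-(t / (16 * (N : ℝ)))) := by
  have hcount : Countable V := InvPerc.countable_of_connected hconn
  set X : InvPerc.Config G → ℕ := fun ω => (InvPerc.cluster G ω o).ncard
  have hX : Measurable X := InvPerc.measurable_ncard_cluster G o
  have hXpos : ∀ᵐ ω ∂μ, 1 ≤ X ω := by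
    filter_upwards [hfin] with ω hω
    exact (Set.ncard_pos hω).2 ⟨o, SimpleGraph.Reachable.refl _⟩
  have hX0 : μ (X ⁻¹' {0}) = 0 := by
    refine measure_mono_null (fun ω hω => ?_) hXpos
    have : X ω = 0 := hω
    simp [this]
  have hN0 : (0 : ℝ) < N := by exact_mod_cast hN
  set q := Real.exp (-1 / (N : ℝ)) with hq
  have hq1 : q < 1 := Real.exp_lt_one_iff.2 (div_neg_of_neg_of_pos (by norm_num) hN0)
  have hq0 : 0 < q := Real.exp_pos _
  have hlaw' : ∀ m : ℕ, 1 ≤ m → μ.real (X ⁻¹' {m}) = C * q ^ m := by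
    intro m hm
    rw [hq, ← Real.exp_nat_mul, mul_div_assoc', mul_neg_one]
    exact hlaw m hm
  have hCq := InvPerc.const_eq_of_geometric hX hX0 hq0 hq1 hlaw'
  have hCpos : 0 < C := by rw [hCq]; exact div_pos (by linarith) hq0
  -- If δ = 0, then `G` is a single vertex, yet the law charges clusters of size 2.
  have hδ1 : 1 ≤ δ := by
    by_contra h
    have hδ0 : δ = 0 := by omega
    have hadj : ∀ v w, ¬ G.Adj v w := by
      intro v w hvw
      have h1 := (G.degree_pos_iff_exists_adj v).2 ⟨w, hvw⟩
      rw [hδ v] at h1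
      omega
    have hsub : Subsingleton V := ⟨fun v w => by
      by_contra hvw
      obtain ⟨p⟩ := hconn.preconnected v w
      cases p with
      | nil => exact hvw rfl
      | cons h _ => exact hadj _ _ h⟩
    have h2 : X ⁻¹' {2} = ∅ := by
      refine Set.eq_empty_of_forall_notMem fun ω hω => ?_
      have h3 : X ω = 2 := hω
      have h4 : X ω ≤ 1 := Set.ncard_le_one_of_subsingleton _
      omega
    have h5 := hlaw' 2 (by norm_num)
    rw [h2, measureReal_empty] at h5
    have : 0 < C * q ^ 2 := by positivity
    linarith
  have hδ0 : (0 : ℝ) < δ := by exact_mod_cast hδ1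
  have ht0 : 0 < t := lt_of_lt_of_le (by positivity) ht
  set F : ℕ → ℝ := fun m => Real.exp (-(4 * (1 / (δ : ℝ)) * t / (m : ℝ) ^ 2)) with hF
  have hF0 : ∀ m, 0 ≤ F m := fun m => (Real.exp_pos _).le
  have hF1 : ∀ m, F m ≤ 1 := fun m => Real.exp_le_one_iff.2 (neg_nonpos.2 (by positivity))
  have hint2 : Integrable (fun ω => 1 / (X ω : ℝ)) μ := by
    refine Integrable.of_bound (C := 1) ?_ (Filter.Eventually.of_forall fun ω => ?_)
    · exact (Measurable.of_discrete (f := fun m : ℕ => 1 / (m : ℝ))).comp hX |>.aestronglyMeasurable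
    · rw [Real.norm_of_nonneg (by positivity), one_div]
      exact Nat.cast_inv_le_one _
  have hintF : Integrable (fun ω => F (X ω)) μ := by
    refine Integrable.of_bound (C := 1) ?_ (Filter.Eventually.of_forall fun ω => ?_)
    · exact (Measurable.of_discrete (f := F)).comp hX |>.aestronglyMeasurable
    · rw [Real.norm_of_nonneg (hF0 _)]
      exact hF1 _
  have hle : ∀ᵐ ω ∂μ, InvPerc.rrwHeat (InvPerc.openGraph G ω) δ t o o
      ≤ 1 / (X ω : ℝ) + F (X ω) := by
    filter_upwards [hfin] with ω hω
    exact (InvPerc.hasSum_rrwHeat_of_finite hω hδ1 ht0.le).2.2.2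
  have hnn : ∀ᵐ ω ∂μ, 0 ≤ InvPerc.rrwHeat (InvPerc.openGraph G ω) δ t o o := by
    filter_upwards [hfin] with ω hω
    exact (InvPerc.hasSum_rrwHeat_of_finite hω hδ1 ht0.le).2.2.1
  have hint1 : Integrable (fun ω => InvPerc.rrwHeat (InvPerc.openGraph G ω) δ t o o) μ := by
    refine (hint2.add hintF).mono'
      (InvPerc.aemeasurable_rrwHeat hfin hδ1 ht0.le).aestronglyMeasurable ?_
    filter_upwards [hle, hnn] with ω h1 h2
    rw [Real.norm_of_nonneg h2]
    exact h1
  refine ⟨hint1, hint2, ?_⟩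
  have hmain := integral_mono_ae hint1 (hint2.add hintF) hle
  simp only [Pi.add_apply] at hmain
  rw [integral_add hint2 hintF] at hmain
  set y := (4 * t / ((δ : ℝ) * (N : ℝ) ^ 2)) ^ (1 / 3 : ℝ) with hy
  have hy0 : 0 ≤ y := by positivity
  have hty : t = δ * ((N : ℝ) ^ 2 * (y ^ 3 / 4)) := by
    have h3 : y ^ 3 = 4 * t / ((δ : ℝ) * (N : ℝ) ^ 2) := by
      rw [hy, ← Real.rpow_natCast, ← Real.rpow_mul (by positivity)]; norm_num
    rw [h3]; field_simp
  set p := Real.exp (-(1 / (2 * (N : ℝ)))) with hp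
  have hp0 : 0 < p := Real.exp_pos _
  have hp1 : p < 1 := Real.exp_lt_one_iff.2 (by rw [neg_lt_zero]; positivity)
  have hpq : q = p ^ 2 := by
    rw [hp, hq, ← Real.exp_nat_mul]; congr 1; push_cast; field_simp
  have hbound := InvPerc.integral_le_of_geometric_bound hX hX0 hF0
    (K := C * Real.exp (-(1.185 * y))) (p := p) (by positivity) hp0 hp1 (by
      intro m hm
      have h := Real.exp_neg_div_mul_exp_neg_le (m := m) (by exact_mod_cast hm) hN0 hδ0 hy0 hty
      have hqm : q ^ m = Real.exp (-(m : ℝ) / N) := by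
        rw [hq, ← Real.exp_nat_mul, mul_div_assoc', mul_neg_one]
      have hpm : p ^ m = Real.exp (-(1 / (2 * (N : ℝ))) * m) := by
        rw [hp, ← Real.exp_nat_mul, mul_comm]
      rw [hlaw' m hm, hqm, hpm]
      have := mul_le_mul_of_nonneg_left h hCpos.le
      simp only [hF]
      linarith)
  -- Since q = p², the product is exactly 1 + 1/p, at most 1 + √e for all N ≥ 1.
  have hconst : C * (p / (1 - p)) ≤ 2.65 := by
    have e : C * (p / (1 - p)) = 1 + p⁻¹ := by
      have : 1 - p ≠ 0 := by linarith
      rw [hCq, hpq]; field_simp; ring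
    have hpi : p⁻¹ ≤ 1.65 := by
      rw [hp, ← Real.exp_neg, neg_neg]
      have h1 : (1 : ℝ) / (2 * N) ≤ 1 / 2 := by
        apply one_div_le_one_div_of_le two_pos
        have : (1 : ℝ) ≤ N := by exact_mod_cast hN
        linarith
      refine (Real.exp_le_exp.2 h1).trans ?_
      have h2 : Real.exp (1 / 2) ^ 2 = Real.exp 1 := by rw [← Real.exp_nat_mul]; norm_num
      have h3 := Real.exp_one_lt_d9
      exact abs_le_of_sq_le_sq' (by rw [h2]; linarith) (by norm_num) |>.2
    rw [e]; linarith
  have hfinal := InvPerc.exp_le_cC_mul hδ1 hN ht0 hy0 hty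
  have h6 : C * Real.exp (-(1.185 * y)) * (p / (1 - p)) ≤ 2.65 * Real.exp (-(1.185 * y)) := by
    rw [mul_right_comm]
    exact mul_le_mul_of_nonneg_right hconst (Real.exp_pos _).le
  have h7 : 0 ≤ Real.sqrt (InvPerc.rhoC δ) * t ^ (1 / 4 : ℝ)
      * Real.exp (-(4 * Real.sqrt t / ((δ : ℝ) * InvPerc.rhoC δ))) := by positivity
  have h8 := Real.exp_pos (-(t / (16 * (N : ℝ))))
  linarith
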